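/- Let $N\ge 7$ and let $X_1,\dots,X_N$ be i.i.d. $\mathcal N(\mu,\Sigma)$ in $\mathbb R^d$, where $\mu\in\mathbb R^d$ and $\Sigma\neq 0$ is a symmetric positive semidefinite matrix, both unknown. Write $\hat\mu=\frac1N\sum_{i=1}^N X_i$, $s^2=\operatorname{Tr}\Sigma/N$ (the risk of $\hat\mu$) and $d^{e}=\operatorname{Tr}\Sigma/\|\Sigma\|_\infty$, with $\|\cdot\|_\infty$ the operator norm. Consider $Q$-aggregation of two bags, the target bag $X_1,\dots,X_N$ and a reference bag whose mean is known to be $0$ (so its naive estimate is exactly $0$): for weights $\omega=(\omega_1,\omega_2)$ in the simplex $\mathcal S_2=\{\omega_1,\omega_2\ge 0,\ \omega_1+\omega_2=1\}$ put $$\hat L(\omega)=\|\omega_2\,\hat\mu\|^2+(2\omega_1-1)\hat s^2,\qquad \hat s^2=\frac{1}{N(N-1)}\sum_{i=1}^N\|X_i-\hat\mu\|^2,$$ $$\hat Q(\omega)=\omega_2\sqrt{\hat q/N},\qquad \hat q=\frac1{N-1}\sum_{i=1}^N\langle\hat\mu,X_i-\hat\mu\rangle^2 .$$ For $3\le u_0\le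 (N-1)/2$ let $\hat\omega$ be any measurable selection of $$\hat\omega\in\arg\min_{\omega\in\mathcal S_2}\bigl(\hat L(\omega)+16\sqrt{u_0}\,\hat Q(\omega)\bigr),$$ and let $R(\hat\omega)=\mathbb E\|\hat\omega_1\hat\mu-\mu\|^2$ be the risk of the resulting estimator $\hat\omega_1\hat\mu+\hat\omega_2\cdot 0$, which does not use $\Sigma$. (i) There is an absolute constant $C>0$ such that for all $d$, $N$, $\mu$, $\Sigma$, $u_0$ and $\hat\omega$ as above, $$\frac{R(\hat\omega)}{s^2}\le\frac{\|\mu\|^2}{s^2+\|\mu\|^2}\bigl(1+Ce^{-u_0/2}\bigr)+C\sqrt{\frac{u_0}{d^{e}}}.$$ (ii) Consequently the Pinsker bound is attained asymptotically: for every $\tau\ge 0$ and every choice of $u_0=u_0(d^e)$ with $u_0\to\infty$ and $u_0=o(d^e)$ as $d^e\to\infty$, $$\limsup_{d^e\to\infty}\ \sup_{\|\mu\|^2\le\tau s^2}\frac{R(\hat\omega)}{s^2}\le\frac{\tau}{1+\tau},$$ where for each value of $d^e$ the supremum is over all $d$, $N\ge 7$, $\mu$, $\Sigma$ and $\hat\omega$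 as above with the given effective dimension, $3\le u_0(d^e)\le (N-1)/2$ and $\|\mu\|^2\le\tau s^2$. -/

import Mathlib

open MeasureTheory ProbabilityTheory Filter
open scoped ENNReal Topology

namespace QAgg

noncomputable section

/-- `ℝ^d` with its Euclidean norm. -/
abbrev E (d : ℕ) := EuclideanSpace ℝ (Fin d)

/-! ### Quantities attached to the distribution of the target bag -/

/-- Operator norm `‖Σ‖_∞` of a matrix acting on Euclidean space. -/
def opNorm {d : ℕ} (S : Matrix (Fin d) (Fin d) ℝ) : ℝ :=
  ‖Matrix.toEuclideanCLM (𝕜 := ℝ) S‖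

/-- Effective dimension `d^e = Tr Σ / ‖Σ‖_∞`. -/
def effDim {d : ℕ} (S : Matrix (Fin d) (Fin d) ℝ) : ℝ :=
  S.trace / opNorm S

/-- Naive risk `s² = Tr Σ / N`, the risk of the empirical mean of `N` observations. -/
def naiveRisk {d : ℕ} (N : ℕ) (S : Matrix (Fin d) (Fin d) ℝ) : ℝ :=
  S.trace / N

/-- Law of a bag of `N` independent observations with distribution `𝒩(μ, Σ)`. -/
def sampleLaw {d : ℕ} (N : ℕ) (μ : E d) (S : Matrix (Fin d) (Fin d) ℝ) :
    Measure (Fin N → E d) :=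
  Measure.pi fun _ => multivariateGaussian μ S

/-! ### Q-aggregation

There are `K + 1` bags; bag `0` is the target, observed through the sample `x`, and
`m : Fin K → E d` are the naive estimates of the other bags. The procedure depends on the other
bags only through `m`. -/

/-- Empirical mean of a bag. -/
def empMean {d N : ℕ} (x : Fin N → E d) : E d :=
  (N : ℝ)⁻¹ • ∑ i, x i

/-- The naive estimates of all bags, the target bag first. -/
def naive {d N K : ℕ} (x : Fin N → E d) (m : Fin K → E d) : Fin (K + 1) → E d :=
  Fin.cons (empMean x) m

/-- The unbiased estimate `ŝ²` of the naive risk of the target bag. -/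
def sHatSq {d N : ℕ} (x : Fin N → E d) : ℝ :=
  (∑ i, ‖x i - empMean x‖ ^ 2) / ((N : ℝ) * ((N : ℝ) - 1))

/-- `q̂_k`, for the bag whose naive estimate is `v`. -/
def qHat {d N : ℕ} (x : Fin N → E d) (v : E d) : ℝ :=
  (∑ i, (inner ℝ (empMean x - v) (x i - empMean x)) ^ 2) / ((N : ℝ) - 1)

/-- The unbiased risk estimate `L̂(ω)`. -/
def LHat {d N K : ℕ} (x : Fin N → E d) (m : Fin K → E d) (ω : Fin (K + 1) → ℝ) : ℝ :=
  ‖∑ k : Fin K, ω k.succ • (m k - empMean x)‖ ^ 2 + (2 * ω 0 - 1) * sHatSq x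

/-- The penalty `Q̂(ω)`. -/
def QHat {d N K : ℕ} (x : Fin N → E d) (m : Fin K → E d) (ω : Fin (K + 1) → ℝ) : ℝ :=
  ∑ k : Fin K, ω k.succ * Real.sqrt (qHat x (m k) / N)

/-- The Q-aggregation objective `L̂(ω) + 16 √u₀ Q̂(ω)`. -/
def objective {d N K : ℕ} (u₀ : ℝ) (x : Fin N → E d) (m : Fin K → E d)
    (ω : Fin (K + 1) → ℝ) : ℝ :=
  LHat x m ω + 16 * Real.sqrt u₀ * QHat x m ω

/-- `ω` is a Q-aggregation weight vector: a minimiser of the objective over the simplex. -/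
def IsWeight {d N K : ℕ} (u₀ : ℝ) (x : Fin N → E d) (m : Fin K → E d)
    (ω : Fin (K + 1) → ℝ) : Prop :=
  ω ∈ stdSimplex ℝ (Fin (K + 1)) ∧
    IsMinOn (objective u₀ x m) (stdSimplex ℝ (Fin (K + 1))) ω

/-- The aggregated estimator `∑ₖ ωₖ μ̂ₖ`. -/
def aggregate {d N K : ℕ} (x : Fin N → E d) (m : Fin K → E d) (ω : Fin (K + 1) → ℝ) : E d :=
  ∑ k, ω k • naive x m k

/-! ### James–Stein setting: `B = 2` bags, the second with naive estimate exactly `0`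
(known mean `0`, infinite sample size) -/

/-- The naive estimate of the single reference bag. -/
def jsRef (d : ℕ) : Fin 1 → E d := fun _ => 0

/-- `ω` selects measurably, for every data set, a Q-aggregation weight vector in the
James–Stein setting. -/
def IsJSWeights {d N : ℕ} (u₀ : ℝ) (ω : (Fin N → E d) → Fin 2 → ℝ) : Prop :=
  Measurable ω ∧ ∀ x, IsWeight u₀ x (jsRef d) (ω x)

/-- The risk `E ‖μ̂_ω - μ‖²` of the aggregation estimator with data-dependent weights `ω`. -/
def risk {d N : ℕ} (μ : E d) (S : Matrix (Fin d) (Fin d) ℝ)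
    (ω : (Fin N → E d) → Fin 2 → ℝ) : ℝ≥0∞ :=
  ∫⁻ x, ENNReal.ofReal (‖aggregate x (jsRef d) (ω x) - μ‖ ^ 2) ∂(sampleLaw N μ S)

/-- The relative risk `R(ω) / s²`. -/
def relRisk {d N : ℕ} (μ : E d) (S : Matrix (Fin d) (Fin d) ℝ)
    (ω : (Fin N → E d) → Fin 2 → ℝ) : ℝ≥0∞ :=
  risk μ S ω / ENNReal.ofReal (naiveRisk N S)

/-- Supremum of the relative risk of Q-aggregation with calibration parameter `u₀` over all
Gaussian James–Stein problems of effective dimension `D` with `‖μ‖² ≤ τ s²`: all ambient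
dimensions, covariances, means, and sample sizes for which `u₀` is admissible. -/
def worstRelRisk (τ D u₀ : ℝ) : ℝ≥0∞ :=
  sSup {r | ∃ (d N : ℕ) (S : Matrix (Fin d) (Fin d) ℝ) (μ : E d)
      (ω : (Fin N → E d) → Fin 2 → ℝ),
    7 ≤ N ∧ 3 ≤ u₀ ∧ u₀ ≤ ((N : ℝ) - 1) / 2 ∧ S.PosSemidef ∧ S ≠ 0 ∧ effDim S = D ∧
      ‖μ‖ ^ 2 ≤ τ * naiveRisk N S ∧ IsJSWeights u₀ ω ∧ r = relRisk μ S ω}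

end

end QAgg

namespace QAgg

/-! Write `t` for the weight of the reference bag, `s2` for the naive risk, `m2 = ‖μ‖²`, `η =
(d^e)^(-1/2)`. If `s2` and `m2` were known, the weight `p = s2 / (s2 + m2)` would give exactly the
Pinsker risk `s2 * m2 / (s2 + m2)`. The data-driven `t` is compared with `p` on each data set,
deterministically, and the error terms are averaged afterwards; second moments suffice, so no
concentration inequality is needed and the bound holds even without the exponential term.

The loss differs from the unpenalised objective only through `‖μ̂ - μ‖² - s2`, `ŝ² - s2` and `e =
⟨μ, μ̂ - μ⟩`. The first two have standard deviation of order `s2 * η`, which is affordable. The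
third has size up to `√(s2 * m2) * η`, too large when `m2 ≫ s2`, but it enters multiplied by `t`.
Comparing the minimiser with weight `0` gives `t * ‖μ̂‖² ≤ 2 ŝ²`, so `t` is of order `s2 / m2`
unless the noise is exceptionally large (`weight_mul_abs_le`). AM-GM at scale `s2 * η` then makes
all errors quadratic (`scalar_loss_le`, `loss_le`).

Their means come from Gaussian moments up to order four together with `Tr Σ² ≤ ‖Σ‖ Tr Σ`: each
quadratic error averages to order `s2 * η`, times `√u₀` for the penalty. -/

/-! ### Scalar Gaussian moments. -/

theorem integral_pow_four_gaussianReal (v : NNReal) :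
    ∫ x, x ^ 4 ∂(gaussianReal 0 v) = 3 * (v : ℝ) ^ 2 := by
  have h := iteratedDeriv_mgf_zero (X := id) (μ := gaussianReal 0 v)
    (by simp [integrableExpSet_id_gaussianReal]) 4
  -- Every derivative of the mgf is a polynomial times `exp (v t² / 2)`; differentiating sends the
  -- polynomial `p` to `p' + v t p`. Four rounds from `p = 1` leave `3 v²` at `t = 0`.
  have hd (p p' : ℝ → ℝ) (hp : ∀ t, HasDerivAt p (p' t) t) :
      deriv (fun t => p t * Real.exp ((v : ℝ) * t ^ 2 / 2)) =
        fun t => (p' t + p t * ((v : ℝ) * t)) * Real.exp ((v : ℝ) * t ^ 2 / 2) := by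
    ext t
    have h1 : HasDerivAt (fun t : ℝ => (v : ℝ) * t ^ 2 / 2) ((v : ℝ) * t) t := by
      have := (((hasDerivAt_id t).pow 2).const_mul (v : ℝ)).div_const 2
      refine this.congr_deriv ?_
      simp; ring
    have := (hp t).mul h1.exp
    refine this.deriv.trans ?_
    ring
  have e0 : mgf id (gaussianReal 0 v) =
      fun t => (fun _ => (1 : ℝ)) t * Real.exp ((v : ℝ) * t ^ 2 / 2) := by
    rw [mgf_id_gaussianReal]; simp
  rw [iteratedDeriv_succ', iteratedDeriv_succ', iteratedDeriv_succ', iteratedDeriv_succ',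
    iteratedDeriv_zero, e0, hd _ (fun _ => 0) (fun t => hasDerivAt_const t 1),
    hd _ (fun _ => (v : ℝ)) (fun t => by
      simpa using (hasDerivAt_id t).const_mul (v : ℝ)),
    hd _ (fun t => 2 * (v : ℝ) ^ 2 * t) (fun t => by
      have := (((hasDerivAt_id t).pow 2).const_mul ((v : ℝ) ^ 2)).const_add (v : ℝ)
      refine (this.congr_deriv (by simp; ring)).congr_of_eventuallyEq (.of_forall fun x => ?_)
      simp; ring),
    hd _ (fun t => 3 * (v : ℝ) ^ 2 + 3 * (v : ℝ) ^ 3 * t ^ 2) (fun t => by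
      have := ((hasDerivAt_id t).const_mul (3 * (v : ℝ) ^ 2)).add
        (((hasDerivAt_id t).pow 3).const_mul ((v : ℝ) ^ 3))
      refine (this.congr_deriv (by simp; ring)).congr_of_eventuallyEq (.of_forall fun x => ?_)
      simp; ring)] at h
  simpa using h.symm

theorem integral_sq_gaussianReal (v : NNReal) :
    ∫ x, x ^ 2 ∂(gaussianReal 0 v) = (v : ℝ) := by
  have h := variance_fun_id_gaussianReal (μ := 0) (v := v)
  rw [variance_eq_integral (by fun_prop)] at h
  simpa using h

theorem integrable_pow_gaussianReal (v : NNReal) (n : ℕ) :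
    Integrable (fun x : ℝ => x ^ n) (gaussianReal 0 v) := by
  rcases Nat.eq_zero_or_pos n with rfl | hn
  · simp
  · have h := (memLp_id_gaussianReal' (μ := 0) (v := v) n (by simp)).integrable_norm_pow hn.ne'
    refine h.mono' (by fun_prop) (.of_forall fun x => by simp)

/-- The covariance form `⟨u, S v⟩`. -/
noncomputable def covForm {d : ℕ} (S : Matrix (Fin d) (Fin d) ℝ) (u v : E d) : ℝ :=
  inner ℝ u (Matrix.toEuclideanCLM (𝕜 := ℝ) S v)

/-! ### Linear algebra of a positive semidefinite covariance. -/

section covForm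

variable {d : ℕ} {S : Matrix (Fin d) (Fin d) ℝ}

theorem covForm_add_left (u u' v : E d) :
    covForm S (u + u') v = covForm S u v + covForm S u' v := by
  simp [covForm, inner_add_left]

theorem covForm_sub_left (u u' v : E d) :
    covForm S (u - u') v = covForm S u v - covForm S u' v := by
  simp [covForm, inner_sub_left]

theorem covForm_add_right (u v v' : E d) :
    covForm S u (v + v') = covForm S u v + covForm S u v' := by
  simp [covForm, inner_add_right]

theorem covForm_sub_right (u v v' : E d) :
    covForm S u (v - v') = covForm S u v - covForm S u v' := by
  simp [covForm, inner_sub_right]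

theorem covForm_smul_left (c : ℝ) (u v : E d) : covForm S (c • u) v = c * covForm S u v := by
  simp [covForm, inner_smul_left]

theorem covForm_smul_right (c : ℝ) (u v : E d) : covForm S u (c • v) = c * covForm S u v := by
  simp [covForm, inner_smul_right]

theorem covForm_smul_matrix (c : ℝ) (u v : E d) : covForm (c • S) u v = c * covForm S u v := by
  simp [covForm, inner_smul_right]

theorem covForm_eq_dotProduct (u v : E d) :
    covForm S u v = u.ofLp ⬝ᵥ S.mulVec v.ofLp := by
  simp [covForm, Matrix.inner_toEuclideanCLM]

theorem covForm_comm (hS : S.PosSemidef) (u v : E d) : covForm S u v = covForm S v u := by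
  have h : S.transpose = S := by simpa using hS.isHermitian.eq
  rw [covForm_eq_dotProduct, covForm_eq_dotProduct, Matrix.dotProduct_mulVec,
    ← Matrix.mulVec_transpose, h, dotProduct_comm]

theorem covForm_self_nonneg (hS : S.PosSemidef) (u : E d) : 0 ≤ covForm S u u := by
  rw [covForm_eq_dotProduct]
  simpa using hS.dotProduct_mulVec_nonneg u.ofLp

theorem covForm_self_le (u : E d) : covForm S u u ≤ opNorm S * ‖u‖ ^ 2 := by
  refine (real_inner_le_norm _ _).trans ?_
  have := (Matrix.toEuclideanCLM (𝕜 := ℝ) S).le_opNorm u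
  have hn := norm_nonneg u
  unfold opNorm
  nlinarith

theorem covForm_sq_le (hS : S.PosSemidef) (u v : E d) :
    covForm S u v ^ 2 ≤ covForm S u u * covForm S v v := by
  have h := discrim_le_zero (a := covForm S v v) (b := 2 * covForm S u v) (c := covForm S u u)
    (fun t => by
      have := covForm_self_nonneg hS (u + t • v)
      simp only [covForm_add_left, covForm_add_right, covForm_smul_left, covForm_smul_right,
        covForm_comm hS v u] at this
      linarith)
  unfold discrim at h
  linarith

/-- Cauchy–Schwarz for the form `covForm S` on the pair `(S u, u)`, which needs neither a square
root of `S` nor its spectrum. -/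
theorem norm_sq_toEuclideanCLM_le (hS : S.PosSemidef) (u : E d) :
    ‖Matrix.toEuclideanCLM (𝕜 := ℝ) S u‖ ^ 2 ≤ opNorm S * covForm S u u := by
  set y := Matrix.toEuclideanCLM (𝕜 := ℝ) S u with hy
  have h1 : covForm S y u = ‖y‖ ^ 2 := by simp [covForm, ← hy]
  have h2 := covForm_sq_le hS y u
  have h3 := covForm_self_le (S := S) y
  have h4 := covForm_self_nonneg hS u
  rw [h1] at h2
  rcases eq_or_lt_of_le (sq_nonneg ‖y‖) with h | h
  · rw [← h]
    exact mul_nonneg (norm_nonneg _) h4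
  · have : ‖y‖ ^ 2 * ‖y‖ ^ 2 ≤ ‖y‖ ^ 2 * (opNorm S * covForm S u u) := by nlinarith
    exact le_of_mul_le_mul_left this h

theorem covForm_single (i j : Fin d) :
    covForm S (EuclideanSpace.single i 1) (EuclideanSpace.single j 1) = S i j := by
  simp [covForm_eq_dotProduct]

/-- This is `Tr S² ≤ ‖S‖ Tr S`, the only place where the effective dimension gains over the trace:
the previous bound is applied to each basis vector. -/
theorem sum_sq_entries_le (hS : S.PosSemidef) :
    ∑ i, ∑ j, S i j ^ 2 ≤ opNorm S * S.trace := by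
  rw [Matrix.trace, Finset.mul_sum, Finset.sum_comm]
  refine Finset.sum_le_sum fun j _ => ?_
  have h := norm_sq_toEuclideanCLM_le hS (EuclideanSpace.single j 1)
  rw [covForm_single, EuclideanSpace.norm_sq_eq] at h
  simpa using h

theorem opNorm_pos (hS0 : S ≠ 0) : 0 < opNorm S := by
  unfold opNorm
  rw [norm_pos_iff]
  simpa using hS0

theorem trace_nonneg (hS : S.PosSemidef) : 0 ≤ S.trace := hS.trace_nonneg

/-- The operator norm is at most the Frobenius norm, whose square is at most `‖S‖ Tr S`; one factor
`‖S‖` cancels. -/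
theorem opNorm_le_trace (hS : S.PosSemidef) : opNorm S ≤ S.trace := by
  have htr := trace_nonneg hS
  have hO : 0 ≤ opNorm S := norm_nonneg _
  have hsqrt : opNorm S ≤ Real.sqrt (∑ i, ∑ j, S i j ^ 2) := by
    refine ContinuousLinearMap.opNorm_le_bound _ (Real.sqrt_nonneg _) fun x => ?_
    refine le_of_sq_le_sq ?_ (by positivity)
    rw [mul_pow, Real.sq_sqrt (by positivity), EuclideanSpace.norm_sq_eq, EuclideanSpace.norm_sq_eq,
      Finset.sum_mul]
    refine Finset.sum_le_sum fun i _ => ?_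
    simp only [Real.norm_eq_abs, sq_abs]
    have : (Matrix.toEuclideanCLM (𝕜 := ℝ) S x) i = ∑ j, S i j * x j := by
      simp [Matrix.mulVec, dotProduct]
    rw [this]
    exact Finset.sum_mul_sq_le_sq_mul_sq _ _ _
  have h2 : opNorm S ^ 2 ≤ opNorm S * S.trace := by
    refine le_trans ?_ (sum_sq_entries_le hS)
    have := pow_le_pow_left₀ hO hsqrt 2
    rwa [Real.sq_sqrt (by positivity)] at this
  rcases eq_or_lt_of_le hO with h | h
  · rw [← h]; exact htr
  · exact le_of_mul_le_mul_left (by rwa [sq] at h2) h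

end covForm

/-! ### Moments of a centred Gaussian vector. -/

section moments

variable {d : ℕ} {S : Matrix (Fin d) (Fin d) ℝ}

theorem map_inner_multivariateGaussian (hS : S.PosSemidef) (u : E d) :
    (multivariateGaussian 0 S).map (fun x => inner ℝ u x) =
      gaussianReal 0 (covForm S u u).toNNReal := by
  have h1 : (fun x : E d => inner ℝ u x) = innerSL ℝ u := rfl
  rw [h1, IsGaussian.map_eq_gaussianReal, ContinuousLinearMap.integral_comp_id_comm]
  · have h2 := covarianceBilin_self (μ := multivariateGaussian (0 : E d) S)
      IsGaussian.memLp_two_id u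
    rw [covarianceBilin_multivariateGaussian hS] at h2
    rw [← h1, ← h2, covForm_eq_dotProduct]
    simp
  · exact IsGaussian.integrable_id

theorem integrable_inner_pow (hS : S.PosSemidef) (u : E d) (n : ℕ) :
    Integrable (fun x => inner ℝ u x ^ n) (multivariateGaussian 0 S) := by
  have h := integrable_pow_gaussianReal (covForm S u u).toNNReal n
  rw [← map_inner_multivariateGaussian hS] at h
  exact (integrable_map_measure (measurable_id.pow_const n).aestronglyMeasurable (by fun_prop)).1 h

theorem integral_inner_sq (hS : S.PosSemidef) (u : E d) :
    ∫ x, inner ℝ u x ^ 2 ∂(multivariateGaussian 0 S) = covForm S u u := by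
  have h := integral_sq_gaussianReal (covForm S u u).toNNReal
  rw [← map_inner_multivariateGaussian hS, integral_map (by fun_prop) (by fun_prop)] at h
  rw [h, Real.coe_toNNReal _ (covForm_self_nonneg hS u)]

theorem integral_inner_pow_four (hS : S.PosSemidef) (u : E d) :
    ∫ x, inner ℝ u x ^ 4 ∂(multivariateGaussian 0 S) = 3 * covForm S u u ^ 2 := by
  have h := integral_pow_four_gaussianReal (covForm S u u).toNNReal
  rw [← map_inner_multivariateGaussian hS, integral_map (by fun_prop) (by fun_prop)] at h
  rw [h, Real.coe_toNNReal _ (covForm_self_nonneg hS u)]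

/-- Polarisation: mixed fourth moments reduce to fourth moments of one-dimensional marginals. -/
theorem inner_sq_mul_inner_sq (u v x : E d) :
    inner ℝ u x ^ 2 * inner ℝ v x ^ 2 = 12⁻¹ * (inner ℝ (u + v) x ^ 4 + inner ℝ (u - v) x ^ 4
      - 2 * inner ℝ u x ^ 4 - 2 * inner ℝ v x ^ 4) := by
  simp only [inner_add_left, inner_sub_left]
  ring

theorem integrable_inner_sq_mul_inner_sq (hS : S.PosSemidef) (u v : E d) :
    Integrable (fun x => inner ℝ u x ^ 2 * inner ℝ v x ^ 2) (multivariateGaussian 0 S) := by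
  simp_rw [inner_sq_mul_inner_sq]
  exact ((((integrable_inner_pow hS _ 4).add (integrable_inner_pow hS _ 4)).sub
    ((integrable_inner_pow hS _ 4).const_mul 2)).sub
    ((integrable_inner_pow hS _ 4).const_mul 2)).const_mul _

theorem integral_inner_sq_mul_inner_sq (hS : S.PosSemidef) (u v : E d) :
    ∫ x, inner ℝ u x ^ 2 * inner ℝ v x ^ 2 ∂(multivariateGaussian 0 S) =
      covForm S u u * covForm S v v + 2 * covForm S u v ^ 2 := by
  simp_rw [inner_sq_mul_inner_sq]
  have i1 := integrable_inner_pow hS (u + v) 4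
  have i2 := integrable_inner_pow hS (u - v) 4
  have i3 := (integrable_inner_pow hS u 4).const_mul 2
  have i4 := (integrable_inner_pow hS v 4).const_mul 2
  have i12 : Integrable (fun x => inner ℝ (u + v) x ^ 4 + inner ℝ (u - v) x ^ 4)
    (multivariateGaussian 0 S) := i1.add i2
  have i123 : Integrable (fun x => inner ℝ (u + v) x ^ 4 + inner ℝ (u - v) x ^ 4
    - 2 * inner ℝ u x ^ 4) (multivariateGaussian 0 S) := i12.sub i3
  rw [integral_const_mul, integral_sub i123 i4, integral_sub i12 i3, integral_add i1 i2, integral_const_mul, integral_const_mul]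
  simp only [integral_inner_pow_four hS, covForm_add_left, covForm_add_right, covForm_sub_left,
    covForm_sub_right, covForm_comm hS v u]
  ring

theorem norm_sq_eq_sum_inner (x : E d) :
    ‖x‖ ^ 2 = ∑ i, inner ℝ (EuclideanSpace.single i (1 : ℝ)) x ^ 2 := by
  rw [EuclideanSpace.norm_sq_eq]
  simp [EuclideanSpace.inner_single_left]

theorem integrable_norm_sq (hS : S.PosSemidef) :
    Integrable (fun x : E d => ‖x‖ ^ 2) (multivariateGaussian 0 S) := by
  simp_rw [norm_sq_eq_sum_inner]
  exact integrable_finsetSum _ fun i _ => integrable_inner_pow hS _ 2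

theorem norm_pow_four_eq_sum_inner (x : E d) :
    (‖x‖ ^ 2) ^ 2 = ∑ i, ∑ j, inner ℝ (EuclideanSpace.single i (1 : ℝ)) x ^ 2 *
      inner ℝ (EuclideanSpace.single j (1 : ℝ)) x ^ 2 := by
  rw [norm_sq_eq_sum_inner, sq, Finset.sum_mul_sum]

theorem integrable_norm_pow_four (hS : S.PosSemidef) :
    Integrable (fun x : E d => (‖x‖ ^ 2) ^ 2) (multivariateGaussian 0 S) := by
  simp_rw [norm_pow_four_eq_sum_inner]
  exact integrable_finsetSum _ fun i _ => integrable_finsetSum _ fun j _ =>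
    integrable_inner_sq_mul_inner_sq hS _ _

theorem integrable_norm_sq_sub_sq (hS : S.PosSemidef) (a : ℝ) :
    Integrable (fun x : E d => (‖x‖ ^ 2 - a) ^ 2) (multivariateGaussian 0 S) := by
  have h : (fun x : E d => (‖x‖ ^ 2 - a) ^ 2) =
      fun x => (‖x‖ ^ 2) ^ 2 - 2 * a * ‖x‖ ^ 2 + a ^ 2 := by ext; ring
  rw [h]
  exact ((integrable_norm_pow_four hS).sub ((integrable_norm_sq hS).const_mul _)).add
    (integrable_const _)

theorem integral_norm_sq (hS : S.PosSemidef) :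
    ∫ x : E d, ‖x‖ ^ 2 ∂(multivariateGaussian 0 S) = S.trace := by
  simp_rw [norm_sq_eq_sum_inner]
  rw [integral_finsetSum _ fun i _ => integrable_inner_pow hS _ 2]
  simp [integral_inner_sq hS, covForm_single, Matrix.trace]

theorem integral_norm_pow_four (hS : S.PosSemidef) :
    ∫ x : E d, (‖x‖ ^ 2) ^ 2 ∂(multivariateGaussian 0 S) =
      S.trace ^ 2 + 2 * ∑ i, ∑ j, S i j ^ 2 := by
  simp_rw [norm_pow_four_eq_sum_inner]
  rw [integral_finsetSum _ fun i _ => integrable_finsetSum _ fun j _ =>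
    integrable_inner_sq_mul_inner_sq hS _ _]
  have h (i : Fin d) := integral_finsetSum (μ := multivariateGaussian (0 : E d) S) Finset.univ
    fun j _ => integrable_inner_sq_mul_inner_sq hS (EuclideanSpace.single i (1 : ℝ))
      (EuclideanSpace.single j (1 : ℝ))
  simp_rw [h, integral_inner_sq_mul_inner_sq hS, covForm_single, Finset.sum_add_distrib,
    ← Finset.mul_sum]
  rw [sq S.trace, Matrix.trace, Finset.sum_mul]
  simp

/-- Variance bound for the squared norm of a centred Gaussian vector. -/
theorem integral_norm_sq_sub_trace_sq_le (hS : S.PosSemidef) :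
    ∫ x : E d, (‖x‖ ^ 2 - S.trace) ^ 2 ∂(multivariateGaussian 0 S) ≤
      2 * (opNorm S * S.trace) := by
  have h : (fun x : E d => (‖x‖ ^ 2 - S.trace) ^ 2) =
      fun x => (‖x‖ ^ 2) ^ 2 - 2 * S.trace * ‖x‖ ^ 2 + S.trace ^ 2 := by ext; ring
  have i1 := integrable_norm_pow_four hS
  have i2 := (integrable_norm_sq hS).const_mul (2 * S.trace)
  have i12 : Integrable (fun x : E d => (‖x‖ ^ 2) ^ 2 - 2 * S.trace * ‖x‖ ^ 2)
    (multivariateGaussian 0 S) := i1.sub i2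
  rw [h, integral_add i12 (integrable_const _), integral_sub i1 i2, integral_const_mul,
    integral_norm_sq hS, integral_norm_pow_four hS]
  simp only [integral_const, probReal_univ, smul_eq_mul, one_mul]
  have := sum_sq_entries_le hS
  linarith

end moments

/-! ### Bounds on means through integrable majorants. -/

section MeanLE

variable {Ω : Type*} [MeasurableSpace Ω] {P : Measure Ω}

/-- `f` is dominated by an integrable function of mean at most `b`. -/
def MeanLE (P : Measure Ω) (f : Ω → ℝ) (b : ℝ) : Prop :=
  ∃ H : Ω → ℝ, Integrable H P ∧ (∀ x, f x ≤ H x) ∧ ∫ x, H x ∂P ≤ b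

theorem MeanLE.of_integrable {f : Ω → ℝ} {b : ℝ} (hf : Integrable f P) (h : ∫ x, f x ∂P ≤ b) :
    MeanLE P f b := ⟨f, hf, fun _ => le_rfl, h⟩

theorem MeanLE.const [IsProbabilityMeasure P] (b : ℝ) : MeanLE P (fun _ => b) b :=
  .of_integrable (integrable_const b) (by simp)

theorem MeanLE.mono {f g : Ω → ℝ} {b b' : ℝ} (h : MeanLE P g b) (hfg : ∀ x, f x ≤ g x)
    (hb : b ≤ b') : MeanLE P f b' := by
  obtain ⟨H, h1, h2, h3⟩ := h
  exact ⟨H, h1, fun x => (hfg x).trans (h2 x), h3.trans hb⟩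

theorem MeanLE.add {f g : Ω → ℝ} {b b' : ℝ} (hf : MeanLE P f b) (hg : MeanLE P g b') :
    MeanLE P (fun x => f x + g x) (b + b') := by
  obtain ⟨H, h1, h2, h3⟩ := hf
  obtain ⟨K, k1, k2, k3⟩ := hg
  refine ⟨fun x => H x + K x, h1.add k1, fun x => add_le_add (h2 x) (k2 x), ?_⟩
  rw [integral_add h1 k1]
  exact add_le_add h3 k3

theorem MeanLE.const_mul {f : Ω → ℝ} {b c : ℝ} (hc : 0 ≤ c) (hf : MeanLE P f b) :
    MeanLE P (fun x => c * f x) (c * b) := by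
  obtain ⟨H, h1, h2, h3⟩ := hf
  refine ⟨fun x => c * H x, h1.const_mul c, fun x => mul_le_mul_of_nonneg_left (h2 x) hc, ?_⟩
  rw [integral_const_mul]
  exact mul_le_mul_of_nonneg_left h3 hc

theorem MeanLE.sum {ι : Type*} (s : Finset ι) {f : ι → Ω → ℝ} {b : ι → ℝ}
    (hf : ∀ i, MeanLE P (f i) (b i)) :
    MeanLE P (fun x => ∑ i ∈ s, f i x) (∑ i ∈ s, b i) := by
  choose H h1 h2 h3 using hf
  refine ⟨fun x => ∑ i ∈ s, H i x, integrable_finsetSum _ fun i _ => h1 i,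
    fun x => Finset.sum_le_sum fun i _ => h2 i x, ?_⟩
  rw [integral_finsetSum _ fun i _ => h1 i]
  exact Finset.sum_le_sum fun i _ => h3 i

/-- Only the majorant has to be measurable, so the selected weights cause no measurability
obligation. -/
theorem MeanLE.lintegral_ofReal_le {f : Ω → ℝ} {b : ℝ} (hf : MeanLE P f b) (h0 : ∀ x, 0 ≤ f x) :
    ∫⁻ x, ENNReal.ofReal (f x) ∂P ≤ ENNReal.ofReal b := by
  obtain ⟨H, h1, h2, h3⟩ := hf
  calc ∫⁻ x, ENNReal.ofReal (f x) ∂P ≤ ∫⁻ x, ENNReal.ofReal (H x) ∂P :=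
        lintegral_mono fun x => ENNReal.ofReal_le_ofReal (h2 x)
    _ = ENNReal.ofReal (∫ x, H x ∂P) :=
        (ofReal_integral_eq_lintegral_ofReal h1 (.of_forall fun x => (h0 x).trans (h2 x))).symm
    _ ≤ ENNReal.ofReal b := ENNReal.ofReal_le_ofReal h3

end MeanLE

/-! ### Linear combinations of the observations. -/

section comb

variable {d N : ℕ} {S : Matrix (Fin d) (Fin d) ℝ} {μ : E d}

instance : IsProbabilityMeasure (sampleLaw N μ S) := by
  unfold sampleLaw; infer_instance

/-- Linear combination of the centred observations. -/
noncomputable def comb (μ : E d) (c : Fin N → ℝ) (x : Fin N → E d) : E d :=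
  ∑ i, c i • (x i - μ)

theorem measurable_comb (c : Fin N → ℝ) : Measurable (comb (d := d) μ c) := by
  unfold comb; fun_prop

/-- The characteristic function factorises over the independent observations. The mean, the
residuals and their combinations are all instances, so every needed law is a rescaled `𝒩(0, S)`. -/
theorem map_comb (hS : S.PosSemidef) (c : Fin N → ℝ) :
    (sampleLaw N μ S).map (comb μ c) = multivariateGaussian 0 ((∑ i, c i ^ 2) • S) := by
  have : IsProbabilityMeasure ((sampleLaw N μ S).map (comb μ c)) :=
    Measure.isProbabilityMeasure_map (measurable_comb c).aemeasurable
  apply Measure.ext_of_charFun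
  ext t
  rw [charFun_multivariateGaussian (hS.smul (Finset.sum_nonneg fun i _ => sq_nonneg _)),
    charFun_apply, integral_map (measurable_comb c).aemeasurable
      (Measurable.aestronglyMeasurable (by fun_prop))]
  have hfac (i : Fin N) : ∫ y, Complex.exp (inner ℝ (c i • (y - μ)) t * Complex.I)
      ∂(multivariateGaussian μ S) = Complex.exp (-((c i ^ 2 * covForm S t t : ℝ) : ℂ) / 2) := by
    have h1 := charFun_multivariateGaussian (μ := μ) hS (c i • t)
    rw [charFun_apply] at h1
    have h2 (y : E d) : Complex.exp (inner ℝ (c i • (y - μ)) t * Complex.I) =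
        Complex.exp (inner ℝ y (c i • t) * Complex.I) *
          Complex.exp (-(inner ℝ (c i • t) μ * Complex.I)) := by
      rw [← Complex.exp_add, real_inner_smul_left, inner_sub_left, real_inner_smul_right,
        real_inner_smul_left, real_inner_comm t μ]
      push_cast
      ring_nf
    simp_rw [h2]
    rw [integral_mul_const, h1, ← Complex.exp_add, ← covForm_eq_dotProduct, covForm_smul_left,
      covForm_smul_right]
    push_cast
    ring_nf
  unfold sampleLaw comb
  simp_rw [sum_inner, Complex.ofReal_sum, Finset.sum_mul, Complex.exp_sum]
  rw [integral_fintype_prod_eq_prod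
    (f := fun i (y : E d) => Complex.exp (inner ℝ (c i • (y - μ)) t * Complex.I))]
  simp_rw [hfac]
  rw [← Complex.exp_sum, ← covForm_eq_dotProduct, covForm_smul_matrix]
  simp [Finset.sum_mul, Finset.sum_div, neg_div]

theorem meanLE_inner_comb_sq (hS : S.PosSemidef) (c : Fin N → ℝ) (u : E d) :
    MeanLE (sampleLaw N μ S) (fun x => inner ℝ u (comb μ c x) ^ 2)
      ((∑ i, c i ^ 2) * (opNorm S * ‖u‖ ^ 2)) := by
  have hV : 0 ≤ ∑ i, c i ^ 2 := Finset.sum_nonneg fun i _ => sq_nonneg _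
  have hT := hS.smul hV
  have h1 := integrable_inner_pow hT u 2
  have h2 := integral_inner_sq hT u
  rw [← map_comb (μ := μ) hS c] at h1 h2
  refine .of_integrable (h1.comp_measurable (measurable_comb c)) ?_
  rw [integral_map (measurable_comb c).aemeasurable (by fun_prop)] at h2
  rw [h2, covForm_smul_matrix]
  exact mul_le_mul_of_nonneg_left (covForm_self_le u) hV

theorem meanLE_norm_comb_sq (hS : S.PosSemidef) (c : Fin N → ℝ) :
    MeanLE (sampleLaw N μ S) (fun x => (‖comb μ c x‖ ^ 2 - (∑ i, c i ^ 2) * S.trace) ^ 2)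
      (2 * (∑ i, c i ^ 2) ^ 2 * (opNorm S * S.trace)) := by
  have hV : 0 ≤ ∑ i, c i ^ 2 := Finset.sum_nonneg fun i _ => sq_nonneg _
  have hT := hS.smul hV
  have h1 := integrable_norm_sq_sub_sq hT ((∑ i, c i ^ 2) * S.trace)
  have h2 := integral_norm_sq_sub_trace_sq_le hT
  have h3 : opNorm ((∑ i, c i ^ 2) • S) = (∑ i, c i ^ 2) * opNorm S := by
    simp [opNorm, norm_smul, abs_of_nonneg hV]
  rw [Matrix.trace_smul, h3, smul_eq_mul] at h2
  rw [← map_comb (μ := μ) hS c] at h1 h2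
  refine .of_integrable (h1.comp_measurable (measurable_comb c)) ?_
  rw [integral_map (measurable_comb c).aemeasurable (by fun_prop)] at h2
  refine h2.trans (le_of_eq (by ring))

end comb

/-! ### Second-moment bounds for the statistics of the procedure. -/

section statistics

variable {d N : ℕ} {S : Matrix (Fin d) (Fin d) ℝ} {μ : E d}

/-- Coefficients of the `i`-th residual. -/
noncomputable def resCoef (N : ℕ) (i j : Fin N) : ℝ := (if j = i then 1 else 0) - (N : ℝ)⁻¹

theorem empMean_sub_eq_comb (hN : 0 < N) (x : Fin N → E d) :
    empMean x - μ = comb μ (fun _ => (N : ℝ)⁻¹) x := by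
  have : (N : ℝ) ≠ 0 := by positivity
  simp only [comb, empMean, ← Finset.smul_sum, Finset.sum_sub_distrib, Finset.sum_const,
    Finset.card_univ, Fintype.card_fin, smul_sub]
  congr 1
  rw [← Nat.cast_smul_eq_nsmul ℝ, smul_smul, inv_mul_cancel₀ this, one_smul]

theorem sub_empMean_eq_comb (hN : 0 < N) (i : Fin N) (x : Fin N → E d) :
    x i - empMean x = comb μ (resCoef N i) x := by
  have h : x i - empMean x = (x i - μ) - (empMean x - μ) := by abel
  rw [h, empMean_sub_eq_comb hN]
  simp [comb, resCoef, sub_smul, Finset.sum_sub_distrib]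

theorem sum_sq_inv (hN : 0 < N) : ∑ _j : Fin N, ((N : ℝ)⁻¹) ^ 2 = (N : ℝ)⁻¹ := by
  have : (N : ℝ) ≠ 0 := by positivity
  simp; field_simp

theorem sum_resCoef (hN : 0 < N) (i : Fin N) : ∑ j, resCoef N i j = 0 := by
  have : (N : ℝ) ≠ 0 := by positivity
  simp [resCoef, Finset.sum_sub_distrib, this]

theorem sum_sq_resCoef (hN : 0 < N) (i : Fin N) : ∑ j, resCoef N i j ^ 2 = 1 - (N : ℝ)⁻¹ := by
  have : (N : ℝ) ≠ 0 := by positivity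
  simp [resCoef, sub_sq, Finset.sum_add_distrib, Finset.sum_sub_distrib, ite_pow]
  field_simp; ring

theorem meanLE_norm_empMean_sub (hN : 0 < N) (hS : S.PosSemidef) :
    MeanLE (sampleLaw N μ S) (fun x => (‖empMean x - μ‖ ^ 2 - naiveRisk N S) ^ 2)
      (2 * (opNorm S / N * naiveRisk N S)) := by
  refine (meanLE_norm_comb_sq (μ := μ) hS (fun _ : Fin N => (N : ℝ)⁻¹)).mono (fun x => ?_) ?_
  · rw [sum_sq_inv hN, empMean_sub_eq_comb hN, naiveRisk]
    exact le_of_eq (by ring)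
  · rw [sum_sq_inv hN, naiveRisk]
    exact le_of_eq (by ring)

theorem meanLE_inner_empMean_sub (hN : 0 < N) (hS : S.PosSemidef) (u : E d) :
    MeanLE (sampleLaw N μ S) (fun x => inner ℝ u (empMean x - μ) ^ 2)
      (opNorm S / N * ‖u‖ ^ 2) := by
  refine (meanLE_inner_comb_sq (μ := μ) hS (fun _ : Fin N => (N : ℝ)⁻¹) u).mono (fun x => ?_) ?_
  · rw [empMean_sub_eq_comb hN]
  · rw [sum_sq_inv hN]
    exact le_of_eq (by ring)

/-- Cauchy–Schwarz over the `N` residuals ignores their near independence; the loss is harmless,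
since the result still matches the fluctuation of `‖μ̂ - μ‖²`. -/
theorem meanLE_sHatSq (hN : 2 ≤ N) (hS : S.PosSemidef) :
    MeanLE (sampleLaw N μ S) (fun x => (sHatSq x - naiveRisk N S) ^ 2)
      (2 * (opNorm S / N * naiveRisk N S)) := by
  have hN0 : 0 < N := by omega
  have hNr : (2 : ℝ) ≤ N := by exact_mod_cast hN
  have hN1 : (0 : ℝ) < N - 1 := by linarith
  have hNp : (0 : ℝ) < N := by linarith
  have h := (MeanLE.sum Finset.univ fun i : Fin N =>
    meanLE_norm_comb_sq (μ := μ) hS (resCoef N i)).const_mul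
      (c := ((N : ℝ) * ((N : ℝ) - 1) ^ 2)⁻¹) (by positivity)
  refine h.mono (fun x => ?_) ?_
  · simp_rw [sum_sq_resCoef hN0, ← sub_empMean_eq_comb hN0]
    have e : sHatSq x - naiveRisk N S = ((N : ℝ) * ((N : ℝ) - 1))⁻¹ *
        ∑ i, (‖x i - empMean x‖ ^ 2 - (1 - (N : ℝ)⁻¹) * S.trace) := by
      rw [Finset.sum_sub_distrib, sHatSq, naiveRisk]
      simp
      field_simp
    have cs := sq_sum_le_card_mul_sum_sq (s := (Finset.univ : Finset (Fin N)))
      (f := fun i => ‖x i - empMean x‖ ^ 2 - (1 - (N : ℝ)⁻¹) * S.trace)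
    rw [Finset.card_univ, Fintype.card_fin] at cs
    rw [e, mul_pow]
    refine (mul_le_mul_of_nonneg_left cs (by positivity)).trans (le_of_eq ?_)
    field_simp
  · simp_rw [sum_sq_resCoef hN0]
    simp [naiveRisk]
    refine le_of_eq ?_
    field_simp

/-- Polarisation replaces independence of mean and residual: the inner product is read off from the
squared norms of `k (μ̂ - μ) ± (x i - μ̂)`, each concentrated around the same value. -/
theorem meanLE_inner_empMean_sub_residual (hN : 2 ≤ N) (hS : S.PosSemidef) (i : Fin N) :
    MeanLE (sampleLaw N μ S) (fun x => inner ℝ (empMean x - μ) (x i - empMean x) ^ 2)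
      (2 * (opNorm S * S.trace) / (N - 1)) := by
  have hN0 : 0 < N := by omega
  have hNr : (2 : ℝ) ≤ N := by exact_mod_cast hN
  have hN1 : (0 : ℝ) < N - 1 := by linarith
  have hNp : (0 : ℝ) < N := by linarith
  -- This `k` gives both summands the same variance `(N - 1) / N`. The cross term vanishes because
  -- the residual coefficients sum to zero, so both signs have total variance `V`.
  set k : ℝ := Real.sqrt (N - 1) with hk
  have hk2 : k ^ 2 = N - 1 := Real.sq_sqrt hN1.le
  set V : ℝ := 2 * ((N - 1) / N) with hV
  have hVle : V ^ 2 ≤ 4 := by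
    have : (N - 1) / N ≤ (1 : ℝ) := by rw [div_le_one hNp]; linarith
    have h0 : 0 ≤ ((N : ℝ) - 1) / N := by positivity
    rw [hV]; nlinarith
  have hsum (σ : ℝ) (hσ : σ ^ 2 = 1) : ∑ j, (k * (N : ℝ)⁻¹ + σ * resCoef N i j) ^ 2 = V := by
    have e (j : Fin N) : (k * (N : ℝ)⁻¹ + σ * resCoef N i j) ^ 2 =
        k ^ 2 * ((N : ℝ)⁻¹) ^ 2 + 2 * k * (N : ℝ)⁻¹ * σ * resCoef N i j
          + σ ^ 2 * resCoef N i j ^ 2 := by ring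
    simp_rw [e]
    rw [Finset.sum_add_distrib, Finset.sum_add_distrib, ← Finset.mul_sum, ← Finset.mul_sum,
      ← Finset.mul_sum, sum_resCoef hN0, sum_sq_resCoef hN0, sum_sq_inv hN0, hσ, hk2, hV]
    field_simp; ring
  have hcomb (σ : ℝ) (x : Fin N → E d) : comb μ (fun j => k * (N : ℝ)⁻¹ + σ * resCoef N i j) x =
      k • (empMean x - μ) + σ • (x i - empMean x) := by
    rw [empMean_sub_eq_comb hN0, sub_empMean_eq_comb (μ := μ) hN0 i]
    simp only [comb, Finset.smul_sum, smul_smul, add_smul, Finset.sum_add_distrib]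
  have hp := meanLE_norm_comb_sq (μ := μ) hS (fun j => k * (N : ℝ)⁻¹ + 1 * resCoef N i j)
  have hm := meanLE_norm_comb_sq (μ := μ) hS (fun j => k * (N : ℝ)⁻¹ + (-1) * resCoef N i j)
  rw [hsum 1 (by norm_num)] at hp
  rw [hsum (-1) (by norm_num)] at hm
  have hOT : 0 ≤ opNorm S * S.trace := mul_nonneg (norm_nonneg _) (trace_nonneg hS)
  refine ((hp.add hm).const_mul (c := (8 * ((N : ℝ) - 1))⁻¹) (by positivity)).mono
    (fun x => ?_) ?_
  · simp only [hcomb]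
    rw [norm_add_sq_real, norm_add_sq_real]
    simp only [norm_smul, mul_pow, real_inner_smul_left, Real.norm_eq_abs, sq_abs, one_smul, neg_smul, norm_neg, inner_neg_right]
    set a := inner ℝ (empMean x - μ) (x i - empMean x)
    set T := k ^ 2 * ‖empMean x - μ‖ ^ 2 + ‖x i - empMean x‖ ^ 2 - V * S.trace
    -- `(T + 2ka)² + (T - 2ka)² = 2T² + 8k²a²`, and the `T²` part is discarded.
    have e : (8 * ((N : ℝ) - 1))⁻¹ * (2 * T ^ 2 + 8 * k ^ 2 * a ^ 2) =
        a ^ 2 + (8 * ((N : ℝ) - 1))⁻¹ * (2 * T ^ 2) := by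
      rw [hk2]; field_simp; ring
    have h0 : 0 ≤ (8 * ((N : ℝ) - 1))⁻¹ * (2 * T ^ 2) := by positivity
    calc a ^ 2 ≤ (8 * ((N : ℝ) - 1))⁻¹ * (2 * T ^ 2 + 8 * k ^ 2 * a ^ 2) := by rw [e]; linarith
      _ = _ := by congr 1; simp only [T, a]; ring
  · rw [inv_mul_le_iff₀ (by positivity)]
    have : 8 * ((N : ℝ) - 1) * (2 * (opNorm S * S.trace) / (N - 1)) =
        16 * (opNorm S * S.trace) := by field_simp; ring
    rw [this]
    nlinarith

theorem meanLE_qHat (hN : 2 ≤ N) (hS : S.PosSemidef) :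
    MeanLE (sampleLaw N μ S) (fun x => qHat x 0 / N)
      (16 * (opNorm S / N * (naiveRisk N S + ‖μ‖ ^ 2))) := by
  have hN0 : 0 < N := by omega
  have hNr : (2 : ℝ) ≤ N := by exact_mod_cast hN
  have hN1 : (0 : ℝ) < N - 1 := by linarith
  have hNp : (0 : ℝ) < N := by linarith
  have h := (MeanLE.sum Finset.univ fun i : Fin N =>
    ((meanLE_inner_comb_sq (μ := μ) hS (resCoef N i) μ).const_mul zero_le_two).add
    ((meanLE_inner_empMean_sub_residual (μ := μ) hN hS i).const_mul zero_le_two)).const_mul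
      (c := (((N : ℝ) - 1) * N)⁻¹) (by positivity)
  refine h.mono (fun x => ?_) ?_
  · rw [qHat, div_div, div_eq_inv_mul]
    refine mul_le_mul_of_nonneg_left (Finset.sum_le_sum fun i _ => ?_) (by positivity)
    rw [← sub_empMean_eq_comb hN0]
    have : empMean x - 0 = μ + (empMean x - μ) := by abel
    rw [this, inner_add_left]
    nlinarith [sq_nonneg (inner ℝ μ (x i - empMean x) -
      inner ℝ (empMean x - μ) (x i - empMean x))]
  · simp_rw [sum_sq_resCoef hN0]
    have hO : 0 ≤ opNorm S := norm_nonneg _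
    have hT := trace_nonneg hS
    have e1 : ((N : ℝ) - 1)⁻¹ ≤ 2 * (N : ℝ)⁻¹ := by
      rw [← div_eq_mul_inv, ← one_div, div_le_div_iff₀ hN1 hNp]; linarith
    have e0 : 0 ≤ ((N : ℝ) - 1)⁻¹ := by positivity
    simp only [Finset.sum_const, Finset.card_univ, Fintype.card_fin, nsmul_eq_mul, naiveRisk]
    have e4 : (((N : ℝ) - 1) * N)⁻¹ * (N * (2 * ((1 - (N : ℝ)⁻¹) * (opNorm S * ‖μ‖ ^ 2)) +
        2 * (2 * (opNorm S * S.trace) / (N - 1)))) =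
        2 * (N : ℝ)⁻¹ * (opNorm S * ‖μ‖ ^ 2) + 4 * (((N : ℝ) - 1)⁻¹) ^ 2 * (opNorm S * S.trace) := by
      field_simp
      ring
    rw [e4]
    have e5 : (((N : ℝ) - 1)⁻¹) ^ 2 ≤ 4 * ((N : ℝ)⁻¹) ^ 2 := by
      have := pow_le_pow_left₀ e0 e1 2
      linarith [this, mul_pow 2 ((N : ℝ)⁻¹) 2]
    have h1 : 0 ≤ opNorm S * S.trace := mul_nonneg hO hT
    have h2 : 0 ≤ (N : ℝ)⁻¹ * (opNorm S * ‖μ‖ ^ 2) := by positivity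
    have h3 := mul_le_mul_of_nonneg_right e5 h1
    have e6 : 16 * (opNorm S / N * (S.trace / N + ‖μ‖ ^ 2)) =
        16 * (((N : ℝ)⁻¹) ^ 2 * (opNorm S * S.trace)) +
          16 * ((N : ℝ)⁻¹ * (opNorm S * ‖μ‖ ^ 2)) := by
      field_simp
    rw [e6]
    linarith

end statistics

/-! ### Deterministic scalar inequalities. -/

theorem abs_le_half_sq_div_add {a b : ℝ} (hb : 0 < b) : |a| ≤ (a ^ 2 / b + b) / 2 := by
  rw [← sq_abs a]
  have h : (|a| ^ 2 / b + b) / 2 - |a| = (|a| - b) ^ 2 / (2 * b) := by field_simp; ring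
  have : 0 ≤ (|a| - b) ^ 2 / (2 * b) := by positivity
  linarith

/-- Scalar estimate of the contribution of the linear noise term `e = ⟨μ, μ̂ - μ⟩`, where `t` is
the weight of the reference bag and `v = ŝ²`. -/
theorem weight_mul_abs_le {t s2 m2 e n v η : ℝ} (hs : 0 < s2) (hm : 0 ≤ m2) (hη : 0 < η)
    (hη1 : η ≤ 1) (ht0 : 0 ≤ t) (ht1 : t ≤ 1) (hn : 0 ≤ n)
    (hopt : t * (m2 + 2 * e + n) ≤ 2 * v) :
    t * |e| ≤ 16 * (e ^ 2 / ((s2 + m2) * η)) + 4 * (s2 * η)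
      + 8 * ((v - s2) ^ 2 / (s2 * η)) := by
  have hw : 0 < s2 + m2 := by linarith
  have hX : 0 ≤ e ^ 2 / ((s2 + m2) * η) := by positivity
  have hY : 0 ≤ (v - s2) ^ 2 / (s2 * η) := by positivity
  have hZ : 0 < s2 * η := by positivity
  have he := abs_nonneg e
  rcases le_total m2 s2 with hms | hms
  · have h1 := abs_le_half_sq_div_add (a := e) hZ
    have h2 : e ^ 2 / (s2 * η) ≤ 2 * (e ^ 2 / ((s2 + m2) * η)) := by
      rw [← mul_div_assoc, div_le_div_iff₀ (by positivity) (by positivity)]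
      have : 0 ≤ e ^ 2 * η := by positivity
      nlinarith
    nlinarith
  · have hm0 : 0 < m2 := by linarith
    have hE : e ^ 2 / m2 ≤ 2 * (e ^ 2 / ((s2 + m2) * η)) := by
      rw [← mul_div_assoc, div_le_div_iff₀ (by positivity) (by positivity)]
      have h0 : 0 ≤ e ^ 2 := sq_nonneg e
      have h1 : (s2 + m2) * η ≤ 2 * m2 := by nlinarith
      nlinarith
    -- The bracket is `‖μ̂‖²`. If it is comparable to `m2`, then `hopt` makes `t` of order `v / m2`;
    -- otherwise `|e|` is itself at least `m2 / 4`, so it is dominated by `e² / m2`.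
    by_cases hsmall : m2 ≤ 4 * (m2 + 2 * e + n)
    · have hv : t * m2 ≤ 8 * s2 + 8 * |v - s2| := by
        have := mul_le_mul_of_nonneg_left hsmall ht0
        have := le_abs_self (v - s2)
        linarith
      have h1 : t * |e| ≤ 8 * (s2 * |e| / m2) + 8 * (|v - s2| * |e| / m2) := by
        rw [← mul_add, ← add_div, ← add_mul, ← mul_div_assoc, le_div_iff₀ hm0]
        nlinarith
      have h2 : s2 * |e| / m2 ≤ e ^ 2 / ((s2 + m2) * η) + s2 * η / 2 := by
        have h3 := abs_le_half_sq_div_add (a := e) hZ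
        have h4 : s2 * |e| / m2 ≤ s2 / m2 * ((e ^ 2 / (s2 * η) + s2 * η) / 2) := by
          rw [mul_div_right_comm]
          exact mul_le_mul_of_nonneg_left h3 (by positivity)
        have h5 : s2 / m2 * (e ^ 2 / (s2 * η)) ≤ 2 * (e ^ 2 / ((s2 + m2) * η)) := by
          have : s2 / m2 * (e ^ 2 / (s2 * η)) = e ^ 2 / (m2 * η) := by field_simp
          rw [this, ← mul_div_assoc, div_le_div_iff₀ (by positivity) (by positivity)]
          have : 0 ≤ e ^ 2 * η := by positivity
          nlinarith
        have h6 : s2 / m2 ≤ 1 := by rw [div_le_one hm0]; exact hms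
        nlinarith
      have h7 : |v - s2| * |e| / m2 ≤ ((v - s2) ^ 2 / (s2 * η)) / 2 + (e ^ 2 / m2) / 2 := by
        have h8 : |v - s2| * |e| ≤ ((v - s2) ^ 2 + e ^ 2) / 2 := by
          rw [← sq_abs (v - s2), ← sq_abs e]
          nlinarith [sq_nonneg (|v - s2| - |e|)]
        have h9 : (v - s2) ^ 2 / m2 ≤ (v - s2) ^ 2 / (s2 * η) :=
          div_le_div_of_nonneg_left (sq_nonneg _) hZ (by nlinarith)
        have h10 := div_le_div_of_nonneg_right h8 hm0.le
        have h11 : ((v - s2) ^ 2 + e ^ 2) / 2 / m2 =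
          ((v - s2) ^ 2 / m2) / 2 + (e ^ 2 / m2) / 2 := by ring
        linarith
      linarith
    · have h1 : m2 ≤ 4 * |e| := by
        have := neg_abs_le e
        linarith
      have h2 : |e| ≤ 4 * (e ^ 2 / m2) := by
        rw [← mul_div_assoc, le_div_iff₀ hm0, ← sq_abs e]
        nlinarith
      nlinarith

/-- Comparison of the loss at an optimal weight `t` of the objective with the oracle weight
`s2 / (s2 + m2)`. -/
theorem scalar_loss_le {t s2 m2 e n v η r Q : ℝ} (hs : 0 < s2) (hm : 0 ≤ m2) (hη : 0 < η)
    (hη1 : η ≤ 1) (ht0 : 0 ≤ t) (ht1 : t ≤ 1) (hn : 0 ≤ n) (hr : 0 ≤ r) (hQ0 : 0 ≤ Q)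
    (hopt : t * (m2 + 2 * e + n) ≤ 2 * v)
    (hcmp : t ^ 2 * (m2 + 2 * e + n) + (1 - 2 * t) * v + 16 * r * (t * Q) ≤
      (s2 / (s2 + m2)) ^ 2 * (m2 + 2 * e + n) + (1 - 2 * (s2 / (s2 + m2))) * v
        + 16 * r * (s2 / (s2 + m2) * Q)) :
    (1 - t) ^ 2 * n - 2 * t * (1 - t) * e + t ^ 2 * m2 ≤ s2 * m2 / (s2 + m2)
      + (13 + 8 * r) * (s2 * η)
      + 3 / (2 * (s2 * η)) * (n - s2) ^ 2
      + 17 / (s2 * η) * (v - s2) ^ 2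
      + 34 / ((s2 + m2) * η) * e ^ 2
      + 8 * r / ((s2 + m2) * η) * Q ^ 2 := by
  have hw : 0 < s2 + m2 := by linarith
  have hZ : 0 < s2 * η := by positivity
  have hnoise := weight_mul_abs_le hs hm hη hη1 ht0 ht1 hn hopt
  obtain ⟨p, hp⟩ : ∃ p, p = s2 / (s2 + m2) := ⟨_, rfl⟩
  rw [← hp] at hcmp
  have hp0 : 0 ≤ p := by rw [hp]; positivity
  have hp1 : p ≤ 1 := by rw [hp, div_le_one hw]; linarith
  have horacle : (1 - p) ^ 2 * s2 + p ^ 2 * m2 = s2 * m2 / (s2 + m2) := by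
    rw [hp]; field_simp; ring
  have hA1 := abs_le_half_sq_div_add (a := n - s2) hZ
  have hA2 := abs_le_half_sq_div_add (a := v - s2) hZ
  -- The factor `p` turns the denominator `s2 * η` of AM-GM into `(s2 + m2) * η`, which matches the
  -- variance of `e` and the mean of `Q²`.
  have scale (a : ℝ) : p * |a| ≤ (a ^ 2 / ((s2 + m2) * η) + s2 * η) / 2 := by
    have h1 := mul_le_mul_of_nonneg_left (abs_le_half_sq_div_add (a := a) hZ) hp0
    have h2 : p * ((a ^ 2 / (s2 * η) + s2 * η) / 2) =
        (a ^ 2 / ((s2 + m2) * η) + p * (s2 * η)) / 2 := by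
      rw [hp]; field_simp
    have h3 : p * (s2 * η) ≤ s2 * η := mul_le_of_le_one_left hZ.le hp1
    linarith
  have hA3 := scale e
  have hA4 := scale Q
  rw [abs_of_nonneg hQ0] at hA4
  have hA5 := mul_le_mul_of_nonneg_left hA4 (by positivity : 0 ≤ 16 * r)
  -- Loss minus unpenalised objective at weight `t` is `(1 - 2t)(n - v) - 2te`. The four bounds
  -- below move this difference from `t` to `p` and then replace `n` by `s2`.
  have hb1 : (1 - 2 * t) * (n - v) ≤ (1 - 2 * p) * (n - v) + 2 * |n - s2| + 2 * |v - s2| := by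
    have h1 : |p - t| ≤ 1 := abs_le.2 ⟨by linarith, by linarith⟩
    have h2 : (p - t) * (n - v) ≤ |n - s2| + |v - s2| := by
      refine (le_abs_self _).trans ?_
      rw [abs_mul]
      have h3 : |n - v| ≤ |n - s2| + |v - s2| := by
        rw [abs_sub_comm v s2]; exact abs_sub_le n s2 v
      exact (mul_le_of_le_one_left (abs_nonneg _) h1).trans h3
    linarith
  have hb2 : -(2 * t * e) ≤ 2 * (t * |e|) := by
    linarith [mul_le_mul_of_nonneg_left (neg_abs_le e) ht0]
  have hb3 : (1 - p) ^ 2 * n ≤ (1 - p) ^ 2 * s2 + |n - s2| := by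
    have h1 : (1 - p) ^ 2 ≤ 1 := by nlinarith
    have h2 := mul_le_mul_of_nonneg_left (le_abs_self (n - s2)) (sq_nonneg (1 - p))
    have h3 := mul_le_of_le_one_left (abs_nonneg (n - s2)) h1
    linarith
  have hb4 : -(2 * p * (1 - p) * e) + 2 * p * e ≤ 2 * (p * |e|) := by
    have h1 : p ^ 2 * e ≤ p * |e| :=
      (mul_le_mul_of_nonneg_left (le_abs_self e) (sq_nonneg p)).trans
        (mul_le_mul_of_nonneg_right (pow_le_of_le_one hp0 hp1 two_ne_zero) (abs_nonneg e))
    linarith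
  -- The penalty at `t` is simply dropped; only its value at `p` costs anything.
  have hpen : 0 ≤ 16 * r * (t * Q) := by positivity
  have f1 : 3 / (2 * (s2 * η)) * (n - s2) ^ 2 = 3 / 2 * ((n - s2) ^ 2 / (s2 * η)) := by
    field_simp
  have f2 : 17 / (s2 * η) * (v - s2) ^ 2 = 17 * ((v - s2) ^ 2 / (s2 * η)) := by ring
  have f3 : 34 / ((s2 + m2) * η) * e ^ 2 = 34 * (e ^ 2 / ((s2 + m2) * η)) := by ring
  have f4 : 8 * r / ((s2 + m2) * η) * Q ^ 2 = 8 * r * (Q ^ 2 / ((s2 + m2) * η)) := by ring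
  rw [f1, f2, f3, f4]
  have hX : 0 ≤ e ^ 2 / ((s2 + m2) * η) := by positivity
  linarith

/-! ### The two-bag objective and the oracle inequality. -/

section weights

variable {d N : ℕ}

theorem objective_jsRef (u₀ t : ℝ) (x : Fin N → E d) :
    objective u₀ x (jsRef d) ![1 - t, t] = t ^ 2 * ‖empMean x‖ ^ 2 + (1 - 2 * t) * sHatSq x
      + 16 * Real.sqrt u₀ * (t * Real.sqrt (qHat x 0 / N)) := by
  simp [objective, LHat, QHat, jsRef, norm_smul, mul_pow]
  left
  ring

theorem mem_stdSimplex_pair {t : ℝ} (h0 : 0 ≤ t) (h1 : t ≤ 1) :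
    ![1 - t, t] ∈ stdSimplex ℝ (Fin (1 + 1)) := by
  refine ⟨fun i => ?_, by simp⟩
  fin_cases i <;> simp <;> linarith

theorem eq_pair_of_mem_stdSimplex {ω : Fin 2 → ℝ} (h : ω ∈ stdSimplex ℝ (Fin 2)) :
    ω = ![1 - ω 1, ω 1] := by
  have := h.2
  rw [Fin.sum_univ_two] at this
  ext i
  fin_cases i
  · simp; linarith
  · simp

theorem aggregate_jsRef (t : ℝ) (x : Fin N → E d) :
    aggregate x (jsRef d) ![1 - t, t] = (1 - t) • empMean x := by
  simp [aggregate, naive, jsRef]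

/-- Oracle inequality for a single data set. -/
theorem loss_le {u₀ s2 η : ℝ} {μ : E d} {x : Fin N → E d} {ω : Fin 2 → ℝ}
    (hω : IsWeight u₀ x (jsRef d) ω) (hs : 0 < s2) (hη : 0 < η) (hη1 : η ≤ 1)
    (hN : 2 ≤ N) :
    ‖aggregate x (jsRef d) ω - μ‖ ^ 2 ≤ s2 * ‖μ‖ ^ 2 / (s2 + ‖μ‖ ^ 2)
      + (13 + 8 * Real.sqrt u₀) * (s2 * η)
      + 3 / (2 * (s2 * η)) * (‖empMean x - μ‖ ^ 2 - s2) ^ 2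
      + 17 / (s2 * η) * (sHatSq x - s2) ^ 2
      + 34 / ((s2 + ‖μ‖ ^ 2) * η) * (inner ℝ μ (empMean x - μ)) ^ 2
      + 8 * Real.sqrt u₀ / ((s2 + ‖μ‖ ^ 2) * η) * (qHat x 0 / N) := by
  obtain ⟨hmem, hmin⟩ := hω
  set t := ω 1 with ht
  have hpair : ω = ![1 - t, t] := eq_pair_of_mem_stdSimplex hmem
  have ht0 : 0 ≤ t := hmem.1 1
  have ht1 : t ≤ 1 := by
    have h := hmem.2
    have h0 := hmem.1 0
    rw [Fin.sum_univ_two] at h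
    linarith
  have hNr : (2 : ℝ) ≤ N := by exact_mod_cast hN
  have hq : 0 ≤ qHat x 0 / N :=
    div_nonneg (div_nonneg (Finset.sum_nonneg fun i _ => sq_nonneg _) (by linarith)) (by linarith)
  have hle (r : ℝ) (h0 : 0 ≤ r) (h1 : r ≤ 1) := hmin (mem_stdSimplex_pair h0 h1)
  rw [hpair] at hle
  simp only [Set.mem_ofPred_eq, objective_jsRef] at hle
  rw [hpair, aggregate_jsRef]
  set M := empMean x
  set Q := Real.sqrt (qHat x 0 / N) with hQ
  have hQ0 : 0 ≤ Q := Real.sqrt_nonneg _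
  have hQ2 : qHat x 0 / N = Q ^ 2 := (Real.sq_sqrt hq).symm
  set r := Real.sqrt u₀
  have hr : 0 ≤ r := Real.sqrt_nonneg _
  set v := sHatSq x
  set e := inner ℝ μ (M - μ) with he
  set n := ‖M - μ‖ ^ 2 with hn
  set m2 := ‖μ‖ ^ 2 with hm2
  have hn0 : 0 ≤ n := sq_nonneg _
  have hm0 : 0 ≤ m2 := sq_nonneg _
  have hM : ‖M‖ ^ 2 = m2 + 2 * e + n := by
    have : M = μ + (M - μ) := by abel
    rw [this, norm_add_sq_real]
  have hloss : ‖(1 - t) • M - μ‖ ^ 2 = (1 - t) ^ 2 * n - 2 * t * (1 - t) * e + t ^ 2 * m2 := by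
    have : (1 - t) • M - μ = (1 - t) • (M - μ) - t • μ := by
      simp only [smul_sub, sub_smul, one_smul]; abel
    rw [this, norm_sub_sq_real, norm_smul, norm_smul, mul_pow, mul_pow, real_inner_smul_left,
      real_inner_smul_right, real_inner_comm]
    simp only [Real.norm_eq_abs, sq_abs]
    ring
  rw [hloss, hQ2]
  simp only [hM] at hle
  have hw : 0 < s2 + m2 := by linarith
  have hZ : 0 < s2 * η := by positivity
  -- Comparison with weight `0`, that is with the naive estimate, divided by `t`; at `t = 0` it
  -- reduces to `0 ≤ ŝ²`.
  have hopt : t * (m2 + 2 * e + n) ≤ 2 * v := by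
    have h0 := hle 0 le_rfl zero_le_one
    rcases eq_or_lt_of_le ht0 with h | h
    · rw [← h, zero_mul]
      have : 0 ≤ v := div_nonneg (Finset.sum_nonneg fun i _ => sq_nonneg _)
        (mul_nonneg (by linarith) (by linarith))
      linarith
    · have hp : 0 ≤ 16 * r * (t * Q) := by positivity
      refine le_of_mul_le_mul_left ?_ h
      linarith
  have hp0 : 0 ≤ s2 / (s2 + m2) := by positivity
  have hp1 : s2 / (s2 + m2) ≤ 1 := by rw [div_le_one hw]; linarith
  exact scalar_loss_le hs hm0 hη hη1 ht0 ht1 hn0 hr hQ0 hopt (hle _ hp0 hp1)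

end weights

/-! ### Averaging the oracle inequality and passing to the limit. -/

section risk

variable {d N : ℕ} {S : Matrix (Fin d) (Fin d) ℝ} {μ : E d} {u₀ : ℝ}
  {ω : (Fin N → E d) → Fin 2 → ℝ}

theorem relRisk_le (hN : 2 ≤ N) (hu : 1 ≤ u₀) (hS : S.PosSemidef) (hS0 : S ≠ 0)
    (hω : IsJSWeights u₀ ω) :
    relRisk μ S ω ≤ ENNReal.ofReal (‖μ‖ ^ 2 / (naiveRisk N S + ‖μ‖ ^ 2)
      + 220 * Real.sqrt (u₀ / effDim S)) := by
  have hNp : (0 : ℝ) < N := by exact_mod_cast (by omega : 0 < N)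
  have hO := opNorm_pos hS0
  have hOT := opNorm_le_trace hS
  have hT : 0 < S.trace := hO.trans_le hOT
  set s2 := naiveRisk N S with hs2
  have hs : 0 < s2 := div_pos hT hNp
  -- With `η = (d^e)^(-1/2)` the squared errors average to order `s2² η²`, so dividing them by `s2
  -- η` balances the AM-GM remainder `s2 η`.
  set η := Real.sqrt (opNorm S / S.trace) with hη
  have hη0 : 0 < η := Real.sqrt_pos.2 (div_pos hO hT)
  have hη1 : η ≤ 1 := by
    exact Real.sqrt_le_one.2 ((div_le_one hT).2 hOT)
  have hη2 : η ^ 2 = opNorm S / S.trace := Real.sq_sqrt (div_pos hO hT).le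
  have hON : opNorm S / N = s2 * η ^ 2 := by
    rw [hη2, hs2, naiveRisk]; field_simp
  set r := Real.sqrt u₀ with hr
  have hr1 : 1 ≤ r := Real.one_le_sqrt.2 hu
  have hrη : Real.sqrt (u₀ / effDim S) = r * η := by
    rw [hr, hη, effDim, ← Real.sqrt_mul (by linarith)]
    congr 1
    field_simp
  set m2 := ‖μ‖ ^ 2 with hm2
  have hm0 : 0 ≤ m2 := sq_nonneg _
  have hw : 0 < s2 + m2 := by linarith
  have hmean : MeanLE (sampleLaw N μ S)
      (fun x => ‖aggregate x (jsRef d) (ω x) - μ‖ ^ 2)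
      (s2 * (m2 / (s2 + m2) + 220 * (r * η))) := by
    have b1 := (meanLE_norm_empMean_sub (μ := μ) (N := N) (by omega) hS).const_mul
      (c := 3 / (2 * (s2 * η))) (by positivity)
    have b2 := (meanLE_sHatSq (μ := μ) hN hS).const_mul (c := 17 / (s2 * η)) (by positivity)
    have b3 := (meanLE_inner_empMean_sub (μ := μ) (N := N) (by omega) hS μ).const_mul
      (c := 34 / ((s2 + m2) * η)) (by positivity)
    have b4 := (meanLE_qHat (μ := μ) hN hS).const_mul
      (c := 8 * r / ((s2 + m2) * η)) (by positivity)
    have b0 := MeanLE.const (P := sampleLaw N μ S)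
      (s2 * m2 / (s2 + m2) + (13 + 8 * r) * (s2 * η))
    refine ((((b0.add b1).add b2).add b3).add b4).mono
      (fun x => loss_le (hω.2 x) hs hη0 hη1 hN) ?_
    rw [hON, ← hs2, ← hm2]
    have e1 : 3 / (2 * (s2 * η)) * (2 * (s2 * η ^ 2 * s2)) = 3 * (s2 * η) := by field_simp
    have e2 : 17 / (s2 * η) * (2 * (s2 * η ^ 2 * s2)) = 34 * (s2 * η) := by field_simp; ring
    have e3 : 34 / ((s2 + m2) * η) * (s2 * η ^ 2 * m2) ≤ 34 * (s2 * η) := by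
      rw [div_mul_eq_mul_div, div_le_iff₀ (by positivity)]
      have : 0 ≤ s2 * s2 * η ^ 2 := by positivity
      linarith
    have e4 : 8 * r / ((s2 + m2) * η) * (16 * (s2 * η ^ 2 * (s2 + m2))) =
        128 * (r * (s2 * η)) := by field_simp; ring
    -- Since `r ≥ 1`, the terms free of `r` are absorbed: `(13 + 3 + 34 + 34) + (8 + 128) = 220`.
    have e5 : s2 * η ≤ r * (s2 * η) := le_mul_of_one_le_left (by positivity) hr1
    rw [e1, e2, e4, mul_add, ← mul_div_assoc]
    linarith
  have h := hmean.lintegral_ofReal_le fun x => sq_nonneg _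
  rw [hrη, relRisk, risk]
  refine (ENNReal.div_le_div_right h _).trans (le_of_eq ?_)
  rw [ENNReal.ofReal_mul hs.le, mul_comm, ENNReal.mul_div_cancel_right]
  · simpa using hs
  · simp

/-- The risk bound sees the problem only through `m2 / s2` and the effective dimension, and is
increasing in the former, so it is uniform over the class. -/
theorem worstRelRisk_le {τ D : ℝ} (hτ : 0 ≤ τ) :
    worstRelRisk τ D u₀ ≤ ENNReal.ofReal (τ / (1 + τ) + 220 * Real.sqrt (u₀ / D)) := by
  refine sSup_le ?_
  rintro _ ⟨d, N, S, μ, ω, hN, hu, -, hS, hS0, rfl, hμ, hω, rfl⟩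
  refine (relRisk_le (by omega) (by linarith) hS hS0 hω).trans (ENNReal.ofReal_le_ofReal ?_)
  have hs : 0 < naiveRisk N S :=
    div_pos ((opNorm_pos hS0).trans_le (opNorm_le_trace hS)) (by exact_mod_cast (by omega : 0 < N))
  have hm : 0 ≤ ‖μ‖ ^ 2 := sq_nonneg _
  gcongr ?_ + _
  rw [div_le_div_iff₀ (by linarith) (by linarith)]
  linarith

theorem tendsto_sqrt_div_of_isLittleO {f : ℝ → ℝ} (hf : Asymptotics.IsLittleO atTop f fun D => D) :
    Tendsto (fun D => Real.sqrt (f D / D)) atTop (𝓝 0) := by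
  simpa using hf.tendsto_div_nhds_zero.sqrt

end risk

end QAgg

theorem mainTheorem12 :
    (∃ C : ℝ, 0 < C ∧
      ∀ (d N : ℕ) (S : Matrix (Fin d) (Fin d) ℝ) (μ : QAgg.E d) (u₀ : ℝ)
        (ω : (Fin N → QAgg.E d) → Fin 2 → ℝ),
        7 ≤ N → 3 ≤ u₀ → u₀ ≤ ((N : ℝ) - 1) / 2 → S.PosSemidef → S ≠ 0 →
        QAgg.IsJSWeights u₀ ω →
        QAgg.relRisk μ S ω ≤ ENNReal.ofReal
          (‖μ‖ ^ 2 / (QAgg.naiveRisk N S + ‖μ‖ ^ 2) * (1 + C * Real.exp (-u₀ / 2))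
            + C * Real.sqrt (u₀ / QAgg.effDim S))) ∧
    (∀ (τ : ℝ) (u₀ : ℝ → ℝ), 0 ≤ τ → Tendsto u₀ atTop atTop →
      Asymptotics.IsLittleO atTop u₀ (fun D : ℝ => D) →
      limsup (fun D : ℝ => QAgg.worstRelRisk τ D (u₀ D)) atTop
        ≤ ENNReal.ofReal (τ / (1 + τ))) := by
  refine ⟨⟨220, by norm_num, fun d N S μ u₀ ω hN hu _ hS hS0 hω => ?_⟩, fun τ u₀ hτ _ ho => ?_⟩
  · refine (QAgg.relRisk_le (by omega) (by linarith) hS hS0 hω).trans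
      (ENNReal.ofReal_le_ofReal ?_)
    have hs : 0 ≤ QAgg.naiveRisk N S := div_nonneg hS.trace_nonneg N.cast_nonneg
    gcongr ?_ + _
    -- The factor with the exponential is at least `1`, so it only weakens the bound already proved.
    refine le_mul_of_one_le_right (by positivity) ?_
    have := Real.exp_nonneg (-u₀ / 2)
    linarith
  · have h := ((QAgg.tendsto_sqrt_div_of_isLittleO ho).const_mul 220).const_add (τ / (1 + τ))
    rw [mul_zero, add_zero] at h
    rw [← (ENNReal.tendsto_ofReal h).limsup_eq]
    exact limsup_le_limsup (.of_forall fun D => QAgg.worstRelRisk_le hτ)
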